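/- Let $0<q<\tfrac12$. Two teams, G and B, play a match in which every goal is scored by team B with probability $q$ and by team G with probability $1-q$, independently of all other goals. Let $n\ge 1$ be an integer. In Phase I they play until team G has scored $n$ goals. If team B has then scored at least $n$ goals, team B wins. Otherwise they play on (Phase II, without time limit), and team B wins if and only if it ever ties the score. Let $R_n(q)$ be the probability that team B wins. **Theorem.** For every fixed $q$ with $0<q<\tfrac12$, as $n\to\infty$, $$R_n(q)=\frac{(4q(1-q))^n}{\sqrt{\pi}\,(1-2q)}\cdot\frac1{\sqrt n}\left(1+\frac{c_1(q)}{n}+\frac{c_2(q)}{n^2}+\frac{c_3(q)}{n^3}+\frac{c_4(q)}{n^4}\right)+O\!\left(\frac{(4q(1-q))^n}{n^{11/2}}\right),$$ where the implied constant may depend on $q$ and $$c_1(q)=\frac{12q^2-12q-1}{8(2q-1)^2},\qquad c_2(q)=\frac{1}{128}\cdot\frac{400q^4-800q^3+120q^2+280q+1}{(2q-1)^4},$$ $$c_3(q)=\frac{5}{1024}\cdot\frac{1344q^6-4032q^5+112q^4+6496q^3-3444q^2-476q+1}{(2q-1)^6},$$ $$c_4(q)=\frac{21}{32768}\cdot\frac{20224q^8-80896q^7-88832q^6+549632q^5-514400q^4+18368q^3+92368q^2+3536q-1}{(2q-1)^8}.$$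 -/

import Mathlib

/-- A play of the match is a sequence of goals `x : ℕ → Bool`; `x k = true` means that the `k`-th
goal (counted from `0`) is scored by team B, `x k = false` that it is scored by team G.
`goalsB x t` is the number of goals of team B among the first `t` goals. -/
def goalsB (x : ℕ → Bool) (t : ℕ) : ℕ := ((Finset.range t).filter fun k => x k = true).card

/-- The number of goals of team G among the first `t` goals. -/
def goalsG (x : ℕ → Bool) (t : ℕ) : ℕ := ((Finset.range t).filter fun k => x k = false).card

/-- Phase I ends with the `T`-th goal: `T` is the first time at which team G has `n` goals. -/
def PhaseOneEndsAt (n : ℕ) (x : ℕ → Bool) (T : ℕ) : Prop := IsLeast {t | goalsG x t = n} T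

/-- Team B wins the two-phase match: when Phase I ends, either team B has at least `n` goals (and
wins immediately), or the play goes on and team B ties the score at some time of Phase II. -/
def TeamBWins (n : ℕ) (x : ℕ → Bool) : Prop :=
  ∃ T, PhaseOneEndsAt n x T ∧ (n ≤ goalsB x T ∨ ∃ t, T ≤ t ∧ goalsB x t = goalsG x t)

/-- `R_n`: the probability that team B wins the match with parameter `n`, when `X k` tells which
team scores the `k`-th goal. -/
noncomputable def rosenfeld {Ω : Type*} [MeasurableSpace Ω] (μ : MeasureTheory.Measure Ω)
    (X : ℕ → Ω → Bool) (n : ℕ) : ℝ :=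
  μ.real {ω | TeamBWins n fun k => X k ω}

open MeasureTheory ProbabilityTheory Filter Topology

/-! ### Scores along a single play -/

/-! Since `q < 1/2`, the strong law gives team G a final lead almost surely. Hence, up to a null
set, B wins exactly when the score is tied at some time `≥ 2n`: a lead of B must end in a tie, and a
tie in Phase II has at least `n` goals on each side (`teamBWins_iff_exists_tied`).

Splitting off the event that the last tie occurs at time `2n` gives `R_n - R_{n+1} = C(2n,n)
(q(1-q))^n ρ`, with `ρ` the probability of never tying again (`rosenfeld_eq_add`). Summing from `R_0
= 1` to `R_n → 0` with `∑ C(2n,n) z^n = (1-4z)^(-1/2)` yields `ρ = 1 - 2q`. With `y = (1-2q)^2` and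
`f_k = C(2k,k)/4^k`, this means `R_n = (1-2q) ∑_{k ≥ n} (1-y)^k f_k`.

Two expansions in `t = 1/n` remain: that of `√(πn) f_n`, with Wallis' product fixing the constant,
and that of the tail sum divided by `(1-y)^n f_n`, which solves a first-order recurrence. In both,
an explicit polynomial satisfies the recurrence up to a small defect, and
`abs_le_of_abs_sub_succ_le` turns the defect into an error bound. Their product, truncated after
`t^4`, is `winSeries`. -/

theorem goalsB_add_goalsG (x : ℕ → Bool) (t : ℕ) : goalsB x t + goalsG x t = t := by
  have h := Finset.card_filter_add_card_filter_not (s := Finset.range t) (fun k => x k = true)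
  simpa [goalsB, goalsG] using h

theorem goalsB_zero (x : ℕ → Bool) : goalsB x 0 = 0 := by simp [goalsB]

theorem goalsG_zero (x : ℕ → Bool) : goalsG x 0 = 0 := by simp [goalsG]

theorem goalsB_succ (x : ℕ → Bool) (t : ℕ) :
    goalsB x (t + 1) = goalsB x t + if x t = true then 1 else 0 := by
  unfold goalsB
  rw [Finset.range_add_one, Finset.filter_insert]
  split_ifs <;> simp

theorem goalsG_succ (x : ℕ → Bool) (t : ℕ) :
    goalsG x (t + 1) = goalsG x t + if x t = true then 0 else 1 := by
  have h1 := goalsB_add_goalsG x t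
  have h2 := goalsB_add_goalsG x (t + 1)
  have h3 := goalsB_succ x t
  split_ifs at h3 ⊢ <;> omega

theorem goalsB_add (x : ℕ → Bool) (t s : ℕ) :
    goalsB x (t + s) = goalsB x t + goalsB (fun k => x (t + k)) s := by
  induction s with
  | zero => simp [goalsB_zero]
  | succ s ih => rw [← add_assoc, goalsB_succ, goalsB_succ, ih, add_assoc]

theorem goalsG_add (x : ℕ → Bool) (t s : ℕ) :
    goalsG x (t + s) = goalsG x t + goalsG (fun k => x (t + k)) s := by
  have h1 := goalsB_add_goalsG x t
  have h2 := goalsB_add_goalsG x (t + s)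
  have h3 := goalsB_add_goalsG (fun k => x (t + k)) s
  have h4 := goalsB_add x t s
  omega

theorem goalsG_mono (x : ℕ → Bool) : Monotone (goalsG x) :=
  monotone_nat_of_le_succ fun t => by rw [goalsG_succ]; omega

/-- The score is tied after `t` goals. -/
def Tied (x : ℕ → Bool) (t : ℕ) : Prop := goalsB x t = goalsG x t

/-- If team G eventually leads for good, a lead of team B is followed by a tie. -/
theorem exists_tied_of_le (x : ℕ → Bool) {T : ℕ} (hT : goalsG x T ≤ goalsB x T)
    (hx : ∃ N, ∀ t, N ≤ t → goalsB x t < goalsG x t) : ∃ t, T ≤ t ∧ Tied x t := by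
  classical
  obtain ⟨N, hN⟩ := hx
  by_contra! hno
  -- The difference of the scores changes by one per goal, so without a tie B's lead never ends.
  have key : ∀ s, goalsG x (T + s) < goalsB x (T + s) := by
    intro s
    induction s with
    | zero => exact lt_of_le_of_ne hT fun h => hno T le_rfl h.symm
    | succ s ih =>
      have h := hno (T + (s + 1)) (by omega)
      rw [← add_assoc] at h ⊢
      unfold Tied at h
      rw [goalsB_succ, goalsG_succ] at *
      split_ifs at * <;> omega
  exact absurd (key N) (hN (T + N) (by omega)).not_gt

/-- Discrete intermediate values: G's score starts at 0 and grows by at most one per goal. -/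
theorem exists_phaseOneEndsAt (x : ℕ → Bool) {n t : ℕ} (h : n ≤ goalsG x t) :
    ∃ T ≤ t, PhaseOneEndsAt n x T := by
  classical
  have hex : ∃ s, goalsG x s = n ∧ s ≤ t := by
    induction t with
    | zero => exact ⟨0, by simp [goalsG_zero] at h ⊢; omega, le_rfl⟩
    | succ t ih =>
      by_cases h' : n ≤ goalsG x t
      · obtain ⟨s, hs, hst⟩ := ih h'
        exact ⟨s, hs, by omega⟩
      · refine ⟨t + 1, ?_, le_rfl⟩
        rw [goalsG_succ] at h ⊢
        split_ifs at * <;> omega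
  have hex' : ∃ s, goalsG x s = n := hex.imp fun _ hs => hs.1
  obtain ⟨s, hs, hst⟩ := hex
  exact ⟨Nat.find hex', (Nat.find_min' hex' hs).trans hst, Nat.find_spec hex',
    fun r hr => Nat.find_min' hex' hr⟩

/-- When team G eventually leads for good, team B wins iff there is a tie after at least
`2 * n` goals. -/
theorem teamBWins_iff_exists_tied (x : ℕ → Bool) (n : ℕ)
    (hx : ∃ N, ∀ t, N ≤ t → goalsB x t < goalsG x t) :
    TeamBWins n x ↔ ∃ t, 2 * n ≤ t ∧ Tied x t := by
  constructor
  · rintro ⟨T, hT, h⟩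
    have hTG : goalsG x T = n := hT.1
    have hsum := goalsB_add_goalsG x T
    rcases h with h | ⟨t, hTt, ht⟩
    -- Here `T = goalsB x T + n ≥ 2 * n`, so the tie that follows B's lead is late enough.
    · obtain ⟨t, hTt, ht⟩ := exists_tied_of_le x (T := T) (by omega) hx
      exact ⟨t, by omega, ht⟩
    · refine ⟨t, ?_, ht⟩
      have h1 := goalsG_mono x hTt
      have h2 := goalsB_add_goalsG x t
      omega
  · rintro ⟨t, hnt, ht⟩
    have h2 := goalsB_add_goalsG x t
    have ht' : goalsB x t = goalsG x t := ht
    obtain ⟨T, hTt, hT⟩ := exists_phaseOneEndsAt x (n := n) (t := t) (by omega)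
    exact ⟨T, hT, Or.inr ⟨t, hTt, ht⟩⟩

/-- Equal scores cancel, so the match starts afresh at a tie; this is the renewal property behind
the last-tie decomposition. -/
theorem tied_add_iff (x : ℕ → Bool) {t : ℕ} (ht : Tied x t) (s : ℕ) :
    Tied x (t + s) ↔ Tied (fun k => x (t + k)) s := by
  unfold Tied at *
  rw [goalsB_add, goalsG_add, ht]
  omega

theorem tied_two_mul_iff (x : ℕ → Bool) (n : ℕ) : Tied x (2 * n) ↔ goalsB x (2 * n) = n := by
  have h := goalsB_add_goalsG x (2 * n)
  unfold Tied
  omega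

theorem Tied.even {x : ℕ → Bool} {t : ℕ} (h : Tied x t) : t = 2 * goalsB x t := by
  have h2 := goalsB_add_goalsG x t
  unfold Tied at h
  omega

/-- Ties from goal `2 * n` on are ties from goal `2 * (n + 1)` on, unless `2 * n` is the last. -/
theorem exists_tied_iff_or (x : ℕ → Bool) (n : ℕ) :
    (∃ t, 2 * n ≤ t ∧ Tied x t) ↔ (∃ t, 2 * (n + 1) ≤ t ∧ Tied x t) ∨
      (goalsB x (2 * n) = n ∧ ∀ s, 1 ≤ s → ¬ Tied (fun k => x (2 * n + k)) s) := by
  constructor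
  · rintro ⟨t, hnt, ht⟩
    by_cases h : ∃ t, 2 * (n + 1) ≤ t ∧ Tied x t
    · exact Or.inl h
    · refine Or.inr ?_
      have ht2 : t = 2 * n := by
        have h1 := ht.even
        by_contra hne
        exact h ⟨t, by omega, ht⟩
      subst ht2
      refine ⟨(tied_two_mul_iff x n).1 ht, fun s hs hs' => h ⟨2 * n + s, ?_, ?_⟩⟩
      · have h1 := hs'.even
        omega
      · exact (tied_add_iff x ht s).2 hs'
  · rintro (⟨t, hnt, ht⟩ | ⟨h, -⟩)
    · exact ⟨t, by omega, ht⟩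
    · exact ⟨2 * n, le_rfl, (tied_two_mul_iff x n).2 h⟩

/-- The alternatives of `exists_tied_iff_or` exclude each other, so their probabilities add. -/
theorem not_exists_tied_and (x : ℕ → Bool) (n : ℕ) :
    ¬ ((∃ t, 2 * (n + 1) ≤ t ∧ Tied x t) ∧
      (goalsB x (2 * n) = n ∧ ∀ s, 1 ≤ s → ¬ Tied (fun k => x (2 * n + k)) s)) := by
  rintro ⟨⟨t, hnt, ht⟩, h, hno⟩
  obtain ⟨s, rfl⟩ := Nat.exists_eq_add_of_le (show 2 * n ≤ t by omega)
  exact hno s (by omega) ((tied_add_iff x ((tied_two_mul_iff x n).2 h) s).1 ht)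

/-! ### Sequences of independent goals -/

/-- The goals `X k` are independent, and each is scored by team B with probability `q`. -/
structure IsGoalProcess {Ω : Type*} [MeasurableSpace Ω] (μ : Measure Ω) (q : ℝ)
    (X : ℕ → Ω → Bool) : Prop where
  measurable : ∀ k, Measurable (X k)
  indep : iIndepFun X μ
  law : ∀ k, μ.real {ω | X k ω = true} = q

/-- The σ-algebra is left arbitrary so that it can be the one generated by the first `t` goals. -/
theorem measurable_goalsB_of_lt {Ω : Type*} (m : MeasurableSpace Ω) (X : ℕ → Ω → Bool) (t : ℕ)
    (h : ∀ k < t, Measurable[m] (X k)) : Measurable[m] fun ω => goalsB (fun k => X k ω) t := by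
  simp only [goalsB, Finset.card_filter]
  refine Finset.measurable_sum _ fun k hk => ?_
  exact (measurable_of_countable fun b : Bool => if b = true then 1 else 0).comp
    (h k (Finset.mem_range.1 hk))

theorem measurable_goalsB (t : ℕ) : Measurable fun x : ℕ → Bool => goalsB x t :=
  measurable_goalsB_of_lt _ (fun k (x : ℕ → Bool) => x k) t fun k _ => measurable_pi_apply k

theorem measurable_goalsG (t : ℕ) : Measurable fun x : ℕ → Bool => goalsG x t := by
  have h : (fun x : ℕ → Bool => goalsG x t) = fun x => t - goalsB x t := by
    funext x
    have := goalsB_add_goalsG x t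
    omega
  rw [h]
  exact (measurable_of_countable fun b : ℕ => t - b).comp (measurable_goalsB t)

theorem measurableSet_tied (t : ℕ) : MeasurableSet {x : ℕ → Bool | Tied x t} :=
  measurableSet_eq_fun (measurable_goalsB t) (measurable_goalsG t)

theorem measurableSet_exists_tied (N : ℕ) :
    MeasurableSet {x : ℕ → Bool | ∃ t, N ≤ t ∧ Tied x t} := by
  have h : {x : ℕ → Bool | ∃ t, N ≤ t ∧ Tied x t} = ⋃ t, ⋃ (_ : N ≤ t), {x | Tied x t} := by
    ext x; simp
  rw [h]
  exact MeasurableSet.iUnion fun t => MeasurableSet.iUnion fun _ => measurableSet_tied t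

/-- The plays in which the score is never tied again after the start. -/
def neverTied : Set (ℕ → Bool) := {x | ∀ s, 1 ≤ s → ¬ Tied x s}

theorem measurableSet_neverTied : MeasurableSet neverTied := by
  have h : neverTied = {x : ℕ → Bool | ∃ t, 1 ≤ t ∧ Tied x t}ᶜ := by
    ext x; simp [neverTied]
  rw [h]
  exact (measurableSet_exists_tied 1).compl

namespace IsGoalProcess

variable {Ω : Type*} [MeasurableSpace Ω] {μ : Measure Ω} {q : ℝ} {X : ℕ → Ω → Bool}

theorem measurable_shift (h : IsGoalProcess μ q X) (t : ℕ) :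
    Measurable fun ω k => X (t + k) ω :=
  measurable_pi_lambda _ fun k => h.measurable (t + k)

theorem measurable_play (h : IsGoalProcess μ q X) : Measurable fun ω k => X k ω :=
  measurable_pi_lambda _ h.measurable

theorem shift (h : IsGoalProcess μ q X) (t : ℕ) : IsGoalProcess μ q fun k => X (t + k) where
  measurable _ := h.measurable _
  indep := h.indep.precomp (add_right_injective t)
  law _ := h.law _

variable [IsProbabilityMeasure μ]

theorem map_eq (h : IsGoalProcess μ q X) (i j : ℕ) : μ.map (X i) = μ.map (X j) := by
  have htrue : ∀ k, μ.map (X k) {true} = ENNReal.ofReal q := fun k => by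
    rw [Measure.map_apply (h.measurable k) (measurableSet_singleton _), ← h.law k,
      ofReal_measureReal]
    rfl
  have hfalse : ∀ k, μ.map (X k) {false} = 1 - ENNReal.ofReal q := fun k => by
    have := Measure.isProbabilityMeasure_map (μ := μ) (h.measurable k).aemeasurable
    rw [← htrue k, ← prob_compl_eq_one_sub (measurableSet_singleton _)]
    congr 1
    ext b; cases b <;> simp
  refine Measure.ext_of_singleton fun b => ?_
  cases b
  · rw [hfalse, hfalse]
  · rw [htrue, htrue]

/-- By independence both laws are products of one-goal laws, and these agree by `map_eq`. -/
theorem map_play_shift (h : IsGoalProcess μ q X) (t : ℕ) :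
    μ.map (fun ω k => X (t + k) ω) = μ.map fun ω k => X k ω := by
  rw [h.indep.map_fun_eq_infinitePi_map h.measurable,
    (h.shift t).indep.map_fun_eq_infinitePi_map (h.shift t).measurable]
  congr 1
  funext i
  exact h.map_eq _ _

/-- The number of goals of team B among the first `t` goals is independent of what follows. -/
theorem measureReal_goalsB_and_shift (h : IsGoalProcess μ q X) (t k : ℕ) {S : Set (ℕ → Bool)}
    (hS : MeasurableSet S) :
    μ.real {ω | goalsB (fun k => X k ω) t = k ∧ (fun k => X (t + k) ω) ∈ S} =
      μ.real {ω | goalsB (fun k => X k ω) t = k} * μ.real {ω | (fun k => X k ω) ∈ S} := by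
  -- Goals with index below `t` and goals with index at least `t` generate independent σ-algebras.
  have hind := indep_iSup_of_disjoint (fun i => (h.measurable i).comap_le) h.indep.iIndep
    (S := Set.Iio t) (T := Set.Ici t)
    (Set.disjoint_left.2 fun i hi hi' => (not_lt.2 (Set.mem_Ici.1 hi')) hi)
  have hpast : MeasurableSet[⨆ i ∈ Set.Iio t, MeasurableSpace.comap (X i) inferInstance]
      {ω | goalsB (fun k => X k ω) t = k} := by
    refine measurable_goalsB_of_lt _ X t (fun i hi => ?_) (measurableSet_singleton k)
    exact (comap_measurable (X i)).mono
      (le_iSup₂_of_le (f := fun i _ => MeasurableSpace.comap (X i) inferInstance) i hi le_rfl) le_rfl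
  have hfut : Measurable[⨆ i ∈ Set.Ici t, MeasurableSpace.comap (X i) inferInstance]
      (fun ω k => X (t + k) ω) := by
    refine @measurable_pi_lambda _ _ _ (_) _ _ fun i => ?_
    exact (comap_measurable (X (t + i))).mono
      (le_iSup₂_of_le (f := fun i _ => MeasurableSpace.comap (X i) inferInstance) (t + i)
        (Set.mem_Ici.2 (Nat.le_add_right t i)) le_rfl) le_rfl
  have hmul := (Indep_iff _ _ _).1 hind _ _ hpast (hfut hS)
  have hmap : μ ((fun ω k => X (t + k) ω) ⁻¹' S) = μ ((fun ω k => X k ω) ⁻¹' S) := by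
    rw [← Measure.map_apply (h.measurable_shift t) hS, ← Measure.map_apply h.measurable_play hS,
      h.map_play_shift]
  rw [hmap] at hmul
  exact (congrArg ENNReal.toReal hmul).trans ENNReal.toReal_mul

theorem measureReal_false (h : IsGoalProcess μ q X) (k : ℕ) :
    μ.real {ω | X k ω = false} = 1 - q := by
  rw [← h.law k, ← probReal_compl_eq_one_sub]
  · congr 1
    ext ω; simp
  · exact h.measurable k (measurableSet_singleton true)

/-- The number of goals of team B has the binomial distribution. -/
theorem measureReal_goalsB_eq (h : IsGoalProcess μ q X) (t k : ℕ) :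
    μ.real {ω | goalsB (fun k => X k ω) t = k} = t.choose k * q ^ k * (1 - q) ^ (t - k) := by
  -- Goal `t` is the first coordinate of the play shifted by `t`.
  have hnext : ∀ (b : Bool) (t k : ℕ),
      μ.real {ω | goalsB (fun k => X k ω) t = k ∧ X t ω = b} =
        μ.real {ω | goalsB (fun k => X k ω) t = k} * μ.real {ω | X 0 ω = b} := fun b t k =>
    h.measureReal_goalsB_and_shift t k (S := {x | x 0 = b})
      (measurable_pi_apply (X := fun _ => Bool) 0 (measurableSet_singleton b))
  have hmeas : ∀ (b : Bool) (t k : ℕ),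
      MeasurableSet {ω | goalsB (fun k => X k ω) t = k ∧ X t ω = b} := fun b t k =>
    (((measurable_goalsB t).comp h.measurable_play) (measurableSet_singleton k)).inter
      (h.measurable t (measurableSet_singleton b))
  induction t generalizing k with
  | zero => cases k <;> simp [goalsB_zero]
  | succ t ih =>
    cases k with
    | zero =>
      have hset : {ω | goalsB (fun k => X k ω) (t + 1) = 0} =
          {ω | goalsB (fun k => X k ω) t = 0 ∧ X t ω = false} := by
        ext ω
        simp [goalsB_succ]
      rw [hset, hnext, ih, h.measureReal_false]
      simp [pow_succ]
    | succ k =>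
      have hset : {ω | goalsB (fun k => X k ω) (t + 1) = k + 1} =
          {ω | goalsB (fun k => X k ω) t = k + 1 ∧ X t ω = false} ∪
          {ω | goalsB (fun k => X k ω) t = k ∧ X t ω = true} := by
        ext ω
        cases hX : X t ω <;> simp [goalsB_succ, hX]
      rw [hset, measureReal_union _ (hmeas _ _ _), hnext, hnext, ih, ih, h.measureReal_false,
        h.law, Nat.choose_succ_succ]
      · rcases lt_or_ge t (k + 1) with htk | htk
        -- For `t ≤ k` the truncated exponent `t - (k + 1)` is harmless, as its binomial coefficient
        -- vanishes.
        · rw [Nat.choose_eq_zero_of_lt htk, Nat.add_sub_add_right]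
          push_cast
          ring
        · obtain ⟨s, rfl⟩ := Nat.exists_eq_add_of_le htk
          rw [show k + 1 + s - (k + 1) = s by omega, show k + 1 + s - k = s + 1 by omega,
            show k + 1 + s + 1 - (k + 1) = s + 1 by omega]
          push_cast
          ring
      · refine Set.disjoint_left.2 fun ω h1 h2 => ?_
        have := h1.2.symm.trans h2.2
        simp at this

/-- By the strong law of large numbers, team G eventually leads for good. -/
theorem ae_eventually_lt (h : IsGoalProcess μ q X) (hq : q < 1 / 2) :
    ∀ᵐ ω ∂μ, ∃ N, ∀ t, N ≤ t → goalsB (fun k => X k ω) t < goalsG (fun k => X k ω) t := by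
  let f : Bool → ℝ := fun b => if b = true then 1 else 0
  have hf : Measurable f := measurable_of_countable f
  have hint : Integrable (fun ω => f (X 0 ω)) μ := by
    refine Integrable.of_bound (hf.comp (h.measurable 0)).aestronglyMeasurable 1
      (Eventually.of_forall fun ω => ?_)
    simp only [f]
    split_ifs <;> simp
  have hmean : μ[fun ω => f (X 0 ω)] = q := by
    have hind : (fun ω => f (X 0 ω)) = {ω | X 0 ω = true}.indicator 1 := by
      funext ω
      simp [f, Set.indicator_apply]
    rw [hind]
    exact (integral_indicator_one (h.measurable 0 (measurableSet_singleton true))).trans (h.law 0)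
  have hlln := strong_law_ae_real (fun k ω => f (X k ω)) hint
    (fun i j hij => (h.indep.indepFun hij).comp hf hf)
    (fun i => IdentDistrib.comp ⟨(h.measurable i).aemeasurable, (h.measurable 0).aemeasurable,
      h.map_eq i 0⟩ hf)
  filter_upwards [hlln] with ω hω
  rw [hmean] at hω
  obtain ⟨N, hN⟩ := eventually_atTop.1 (hω.eventually_lt_const hq)
  -- `N + 1` rather than `N` makes `t` positive, so the average can be multiplied out.
  refine ⟨N + 1, fun t ht => ?_⟩
  have h1 := hN t (by omega)
  have h2 : ∑ i ∈ Finset.range t, f (X i ω) = goalsB (fun k => X k ω) t := by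
    simp [f, goalsB]
  rw [h2, div_lt_iff₀ (by exact_mod_cast (show 0 < t by omega))] at h1
  have h3 := goalsB_add_goalsG (fun k => X k ω) t
  have h4 : (2 : ℝ) * goalsB (fun k => X k ω) t < t := by linarith
  have h5 : 2 * goalsB (fun k => X k ω) t < t := by exact_mod_cast h4
  omega

theorem rosenfeld_eq (h : IsGoalProcess μ q X) (hq : q < 1 / 2) (n : ℕ) :
    rosenfeld μ X n = μ.real {ω | ∃ t, 2 * n ≤ t ∧ Tied (fun k => X k ω) t} := by
  refine measureReal_congr ?_
  filter_upwards [h.ae_eventually_lt hq] with ω hω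
  exact propext (teamBWins_iff_exists_tied _ n hω)

theorem rosenfeld_zero (h : IsGoalProcess μ q X) (hq : q < 1 / 2) : rosenfeld μ X 0 = 1 := by
  rw [h.rosenfeld_eq hq]
  convert probReal_univ (μ := μ)
  exact Set.eq_univ_of_forall fun ω => ⟨0, by simp, by simp [Tied, goalsB_zero, goalsG_zero]⟩

/-- Continuity from above: the events decrease to "ties at arbitrarily late times", which is null
because G finally leads. -/
theorem tendsto_rosenfeld (h : IsGoalProcess μ q X) (hq : q < 1 / 2) :
    Tendsto (rosenfeld μ X) atTop (𝓝 0) := by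
  let s : ℕ → Set Ω := fun n => {ω | ∃ t, 2 * n ≤ t ∧ Tied (fun k => X k ω) t}
  have hs : ∀ n, MeasurableSet (s n) := fun n =>
    h.measurable_play (measurableSet_exists_tied (2 * n))
  have hanti : Antitone s := fun m n hmn ω ⟨t, ht, htie⟩ => ⟨t, by omega, htie⟩
  have hlim := tendsto_measure_iInter_atTop (μ := μ) (fun n => (hs n).nullMeasurableSet) hanti
    ⟨0, measure_ne_top μ _⟩
  have hnull : μ (⋂ n, s n) = 0 := by
    rw [← nonpos_iff_eq_zero, ← show μ {ω | ¬ ∃ N, ∀ t, N ≤ t →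
      goalsB (fun k => X k ω) t < goalsG (fun k => X k ω) t} = 0 from h.ae_eventually_lt hq]
    refine measure_mono fun ω hω => ?_
    rintro ⟨N, hN⟩
    obtain ⟨t, ht, htie⟩ := Set.mem_iInter.1 hω N
    exact (hN t (by omega)).ne htie
  rw [hnull] at hlim
  have := (ENNReal.tendsto_toReal ENNReal.zero_ne_top).comp hlim
  refine this.congr fun n => ?_
  rw [h.rosenfeld_eq hq]
  rfl

/-- The last tie occurs after `2 * n` goals with probability `rosenfeld μ X n -
rosenfeld μ X (n + 1)`. -/
theorem rosenfeld_eq_add (h : IsGoalProcess μ q X) (hq : q < 1 / 2) (n : ℕ) :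
    rosenfeld μ X n = rosenfeld μ X (n + 1) +
      n.centralBinom * (q * (1 - q)) ^ n * μ.real {ω | (fun k => X k ω) ∈ neverTied} := by
  have hset : {ω | ∃ t, 2 * n ≤ t ∧ Tied (fun k => X k ω) t} =
      {ω | ∃ t, 2 * (n + 1) ≤ t ∧ Tied (fun k => X k ω) t} ∪
      {ω | goalsB (fun k => X k ω) (2 * n) = n ∧ (fun k => X (2 * n + k) ω) ∈ neverTied} := by
    ext ω
    exact exists_tied_iff_or _ n
  rw [h.rosenfeld_eq hq, h.rosenfeld_eq hq, hset, measureReal_union,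
    h.measureReal_goalsB_and_shift _ _ measurableSet_neverTied, h.measureReal_goalsB_eq,
    Nat.centralBinom_eq_two_mul_choose, show 2 * n - n = n by omega, mul_pow, mul_assoc _ (q ^ n)]
  · exact Set.disjoint_left.2 fun ω h1 h2 => not_exists_tied_and _ n ⟨h1, h2⟩
  · exact (((measurable_goalsB (2 * n)).comp h.measurable_play) (measurableSet_singleton n)).inter
      (h.measurable_shift _ measurableSet_neverTied)

end IsGoalProcess

/-! ### The probability that the score is never tied again -/

/-- These are the power series coefficients of `(1 - w)^(-1/2)`, computed from the rising factorial
of 1/2. -/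
theorem ringChoose_half_add_eq (n : ℕ) :
    Ring.choose ((1 / 2 : ℝ) + n - 1) n = n.centralBinom / 4 ^ n := by
  have hfac : (n.factorial : ℝ) ≠ 0 := by exact_mod_cast n.factorial_ne_zero
  have hpoch : ∀ m : ℕ, (ascPochhammer ℝ m).eval (1 / 2) =
      m.factorial * (m.centralBinom / 4 ^ m) := by
    intro m
    induction m with
    | zero => simp
    | succ m ih =>
      have hrec : ((m : ℝ) + 1) * (m + 1).centralBinom = 2 * (2 * m + 1) * m.centralBinom := by
        exact_mod_cast Nat.succ_mul_centralBinom_succ m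
      rw [ascPochhammer_succ_eval, ih, Nat.factorial_succ, pow_succ]
      push_cast
      field_simp
      linear_combination -2 * hrec
  have h := Ring.factorial_nsmul_multichoose_eq_ascPochhammer (1 / 2 : ℝ) n
  rw [Polynomial.ascPochhammer_smeval_eq_eval, hpoch, nsmul_eq_mul] at h
  rw [Ring.choose, show (1 / 2 : ℝ) + n - 1 - n + 1 = 1 / 2 by ring]
  exact mul_left_cancel₀ hfac h

theorem hasSum_centralBinom_mul_pow {z : ℝ} (hz : |4 * z| < 1) :
    HasSum (fun n : ℕ => n.centralBinom * z ^ n) (1 / √(1 - 4 * z)) := by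
  have h := (Real.one_div_one_sub_rpow_hasFPowerSeriesOnBall_zero (1 / 2)).hasSum
    (y := 4 * z) (by
      rw [Metric.mem_eball, edist_zero_right, enorm_eq_nnnorm]
      exact_mod_cast (show ‖4 * z‖₊ < 1 from hz))
  simp only [FormalMultilinearSeries.ofScalars_apply_eq, ringChoose_half_add_eq, zero_add,
    ← Real.sqrt_eq_rpow] at h
  refine h.congr_fun fun n => ?_
  rw [mul_pow, smul_eq_mul]
  field_simp

/-- The probabilities of the possible times of the last tie add up to 1, and their sum is `ρ / √(1 -
4q(1-q)) = ρ / (1 - 2q)`. -/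
theorem IsGoalProcess.measureReal_neverTied {Ω : Type*} [MeasurableSpace Ω] {μ : Measure Ω}
    [IsProbabilityMeasure μ] {q : ℝ} {X : ℕ → Ω → Bool} (h : IsGoalProcess μ q X) (hq0 : 0 < q)
    (hq : q < 1 / 2) : μ.real {ω | (fun k => X k ω) ∈ neverTied} = 1 - 2 * q := by
  set ρ := μ.real {ω | (fun k => X k ω) ∈ neverTied}
  have hsum : HasSum (fun n : ℕ => n.centralBinom * (q * (1 - q)) ^ n) (1 / (1 - 2 * q)) := by
    have habs : |4 * (q * (1 - q))| < 1 := by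
      rw [abs_lt]
      constructor <;> nlinarith [sq_nonneg (1 - 2 * q), mul_pos hq0 (show 0 < 1 - q by linarith)]
    convert hasSum_centralBinom_mul_pow habs using 2
    rw [show 1 - 4 * (q * (1 - q)) = (1 - 2 * q) ^ 2 by ring, Real.sqrt_sq (by linarith)]
  have hpartial : ∀ n, ∑ i ∈ Finset.range n, (i.centralBinom : ℝ) * (q * (1 - q)) ^ i * ρ =
      1 - rosenfeld μ X n := by
    intro n
    rw [show 1 - rosenfeld μ X n = rosenfeld μ X 0 - rosenfeld μ X n by rw [h.rosenfeld_zero hq],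
      ← Finset.sum_range_sub']
    refine Finset.sum_congr rfl fun i _ => ?_
    rw [h.rosenfeld_eq_add hq i]
    ring
  have hlim := (hsum.mul_right ρ).tendsto_sum_nat
  simp only [hpartial] at hlim
  have hone := tendsto_nhds_unique hlim ((h.tendsto_rosenfeld hq).const_sub 1)
  have hpos : (1 - 2 * q) ≠ 0 := by linarith
  field_simp at hone
  linarith

theorem IsGoalProcess.rosenfeld_sub_succ {Ω : Type*} [MeasurableSpace Ω] {μ : Measure Ω}
    [IsProbabilityMeasure μ] {q : ℝ} {X : ℕ → Ω → Bool} (h : IsGoalProcess μ q X) (hq0 : 0 < q)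
    (hq : q < 1 / 2) (n : ℕ) : rosenfeld μ X n - rosenfeld μ X (n + 1) =
      (1 - 2 * q) * (4 * q * (1 - q)) ^ n * (n.centralBinom / 4 ^ n) := by
  rw [h.rosenfeld_eq_add hq n, h.measureReal_neverTied hq0 hq, mul_assoc 4 q, mul_pow 4]
  field_simp
  ring

/-! ### Asymptotic expansion of the central binomial coefficients -/

/-- If the increments of `D` are dominated by the decrements of `B`, and both tend to zero, then
`D` is dominated by `B`. -/
theorem abs_le_of_abs_sub_succ_le {D B : ℕ → ℝ} {N : ℕ}
    (h : ∀ n, N ≤ n → |D n - D (n + 1)| ≤ B n - B (n + 1)) (hD : Tendsto D atTop (𝓝 0))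
    (hB : Tendsto B atTop (𝓝 0)) {n : ℕ} (hn : N ≤ n) : |D n| ≤ B n := by
  have hshift : Tendsto (fun k => n + k) atTop atTop :=
    tendsto_atTop_mono (fun k => Nat.le_add_left k n) tendsto_id
  have hstep : ∀ k, |D (n + k) - D (n + k + 1)| ≤ B (n + k) - B (n + k + 1) := fun k =>
    h _ (by omega)
  -- Both `B - D` and `B + D` decrease to 0, hence are nonnegative.
  have hsub : Antitone fun k => B (n + k) - D (n + k) := antitone_nat_of_succ_le fun k => by
    have := (abs_le.1 (hstep k)).2
    rw [← add_assoc]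
    linarith
  have hadd : Antitone fun k => B (n + k) + D (n + k) := antitone_nat_of_succ_le fun k => by
    have := (abs_le.1 (hstep k)).1
    rw [← add_assoc]
    linarith
  have h1 := hsub.le_of_tendsto ((hB.sub hD).comp hshift) 0
  have h2 := hadd.le_of_tendsto ((hB.add hD).comp hshift) 0
  simp only [add_zero, sub_zero] at h1 h2
  exact abs_le.2 ⟨by linarith, by linarith⟩

theorem exists_forall_Icc_abs_le {f : ℝ → ℝ} (hf : Continuous f) :
    ∃ C, 0 ≤ C ∧ ∀ t, 0 ≤ t → t ≤ 1 → |f t| ≤ C := by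
  obtain ⟨C, hC⟩ := (isCompact_Icc (a := (0 : ℝ)) (b := 1)).exists_bound_of_continuousOn
    hf.continuousOn
  exact ⟨C, (norm_nonneg _).trans (hC 0 (by simp)), fun t h0 h1 => hC t ⟨h0, h1⟩⟩

/-- The probability `centralBinom n / 4 ^ n` of a tie after `2 * n` fair goals. -/
noncomputable def fairTie (n : ℕ) : ℝ := n.centralBinom / 4 ^ n

theorem fairTie_pos (n : ℕ) : 0 < fairTie n := by
  have := n.centralBinom_pos
  unfold fairTie
  positivity

theorem fairTie_le_one (n : ℕ) : fairTie n ≤ 1 := by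
  rw [fairTie, div_le_one (by positivity)]
  exact_mod_cast n.centralBinom_le_four_pow

theorem fairTie_succ (n : ℕ) : fairTie (n + 1) = fairTie n * ((2 * n + 1) / (2 * n + 2)) := by
  have hrec : ((n : ℝ) + 1) * (n + 1).centralBinom = 2 * (2 * n + 1) * n.centralBinom := by
    exact_mod_cast Nat.succ_mul_centralBinom_succ n
  unfold fairTie
  rw [pow_succ]
  field_simp
  linear_combination 2 * hrec

theorem fairTie_succ_of_inv {n : ℕ} (hn : 1 ≤ n) : fairTie (n + 1) =
    fairTie n * ((2 + 1 / (n : ℝ)) / (2 + 2 * (1 / (n : ℝ)))) := by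
  have : (0 : ℝ) < n := by exact_mod_cast hn
  rw [fairTie_succ]
  field_simp

/-- Carries Wallis' limit over to `fairTie`; this is where `π` enters. -/
theorem wallis_eq (n : ℕ) : Real.Wallis.W n = 1 / (fairTie n ^ 2 * (2 * n + 1)) := by
  induction n with
  | zero => simp [Real.Wallis.W, fairTie]
  | succ n ih =>
    have := fairTie_pos n
    rw [Real.Wallis.W_succ, ih, fairTie_succ]
    push_cast
    field_simp
    ring

theorem tendsto_pi_mul_fairTie_sq :
    Tendsto (fun n : ℕ => Real.pi * n * fairTie n ^ 2) atTop (𝓝 1) := by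
  have h1 : Tendsto (fun n : ℕ => (n : ℝ) / (2 * n + 1)) atTop (𝓝 (1 / 2)) := by
    have h0 : Tendsto (fun n : ℕ => 1 / (2 + 1 / (n : ℝ))) atTop (𝓝 (1 / (2 + 0))) :=
      (tendsto_const_nhds (x := (1 : ℝ))).div
        (tendsto_const_nhds.add tendsto_one_div_atTop_nhds_zero_nat) (by norm_num)
    rw [add_zero] at h0
    refine h0.congr' ?_
    filter_upwards [eventually_ge_atTop 1] with n hn
    have : (0 : ℝ) < n := by exact_mod_cast hn
    field_simp
  have h2 := (h1.const_mul Real.pi).div Real.Wallis.tendsto_W_nhds_pi_div_two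
    (by positivity)
  have hlim : Real.pi * (1 / 2) / (Real.pi / 2) = 1 := by field_simp
  rw [hlim] at h2
  refine h2.congr fun n => ?_
  have := fairTie_pos n
  simp only [Pi.div_apply, wallis_eq]
  field_simp

/-- The expansion of `√(π n) * fairTie n` in powers of `t = 1 / n`. -/
noncomputable def fairTieSeries (t : ℝ) : ℝ :=
  1 - t / 8 + t ^ 2 / 128 + 5 / 1024 * t ^ 3 - 21 / 32768 * t ^ 4

theorem continuous_fairTieSeries : Continuous fairTieSeries := by
  unfold fairTieSeries
  fun_prop

/-- Keeps the denominators below away from zero. -/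
theorem half_le_fairTieSeries {t : ℝ} (h0 : 0 ≤ t) (h1 : t ≤ 1) : 1 / 2 ≤ fairTieSeries t := by
  have : t ^ 4 ≤ 1 := pow_le_one₀ h0 h1
  have : 0 ≤ t ^ 2 := by positivity
  have : 0 ≤ t ^ 3 := by positivity
  unfold fairTieSeries
  linarith

/-- With `t = 1 / n`, passing to `n + 1` is the map `t ↦ t / (1 + t)`, so recurrences in `n` become
identities in `t ∈ [0, 1]`. -/
theorem one_div_natCast_succ {n : ℕ} (hn : 1 ≤ n) :
    1 / ((n + 1 : ℕ) : ℝ) = 1 / (n : ℝ) / (1 + 1 / (n : ℝ)) := by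
  have : (0 : ℝ) < n := by exact_mod_cast hn
  push_cast
  field_simp

/-- For `t = 1 / n` the fraction is `E (n + 1) / E n`, where `E n = π n f_n² / fairTieSeries(1/n)²`.
The coefficients of `fairTieSeries` are exactly those that cancel all orders below `t^6`; squaring
avoids roots. -/
theorem exists_forall_fairTieSeries_ratio_le : ∃ C, 0 ≤ C ∧ ∀ t, 0 ≤ t → t ≤ 1 →
    |1 - (2 + t) ^ 2 * fairTieSeries t ^ 2 / (4 * (1 + t) * fairTieSeries (t / (1 + t)) ^ 2)| ≤
      C * t ^ 6 := by
  -- The cofactor of `-t^6` once denominators are cleared; only its boundedness on `[0, 1]` matters.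
  let H : ℝ → ℝ := fun t =>
    65372160 + 309645312 * t + 580743936 * t ^ 2 + 532633312 * t ^ 3 + 228648169 * t ^ 4
    + 26148527 * t ^ 5 - 6412859 * t ^ 6 + 85355 * t ^ 7 + 125947 * t ^ 8 - 35699 * t ^ 9
    - 1869 * t ^ 10 + 441 * t ^ 11
  obtain ⟨C, hC0, hC⟩ := exists_forall_Icc_abs_le (f := H) (by fun_prop)
  refine ⟨C / 32768 ^ 2, by positivity, fun t h0 h1 => ?_⟩
  have hs0 : 0 ≤ t / (1 + t) := by positivity
  have hs1 : t / (1 + t) ≤ 1 := by rw [div_le_one (by positivity)]; linarith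
  have hW := half_le_fairTieSeries hs0 hs1
  set V := fairTieSeries (t / (1 + t)) with hV
  have hV' : 32768 * (1 + t) ^ 4 * V = 32768 * (1 + t) ^ 4 - 4096 * t * (1 + t) ^ 3 +
      256 * t ^ 2 * (1 + t) ^ 2 + 160 * t ^ 3 * (1 + t) - 21 * t ^ 4 := by
    rw [hV, fairTieSeries]
    field_simp
    ring
  have hid : 32768 ^ 2 * (1 + t) ^ 7 * (4 * (1 + t) * V ^ 2 - (2 + t) ^ 2 * fairTieSeries t ^ 2) =
      -(t ^ 6 * H t) := by
    have hsq : 32768 ^ 2 * (1 + t) ^ 8 * V ^ 2 = (32768 * (1 + t) ^ 4 * V) ^ 2 := by ring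
    rw [hV'] at hsq
    simp only [H, fairTieSeries]
    linear_combination 4 * hsq
  have hVpos : 0 < V := by linarith
  -- `V ≥ 1/2` gives `4 V² ≥ 1`.
  have hden : 1 ≤ (1 + t) ^ 8 * (4 * V ^ 2) :=
    one_le_mul_of_one_le_of_one_le (one_le_pow₀ (by linarith)) (by nlinarith)
  have heq : 1 - (2 + t) ^ 2 * fairTieSeries t ^ 2 / (4 * (1 + t) * V ^ 2) =
      -(t ^ 6 * H t) / (32768 ^ 2 * ((1 + t) ^ 8 * (4 * V ^ 2))) := by
    rw [← hid]
    field_simp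
  have hdpos : 0 < 32768 ^ 2 * ((1 + t) ^ 8 * (4 * V ^ 2)) := by positivity
  rw [heq, abs_div, abs_neg, abs_mul, abs_of_nonneg (pow_nonneg h0 6), abs_of_pos hdpos,
    div_le_iff₀ hdpos]
  calc t ^ 6 * |H t| ≤ t ^ 6 * C := by gcongr; exact hC t h0 h1
    _ ≤ t ^ 6 * C * ((1 + t) ^ 8 * (4 * V ^ 2)) := le_mul_of_one_le_right (by positivity) hden
    _ = _ := by ring

/-- `E` tends to 1 with increments of order `t^6`; summing them costs one power, so `E - 1`, and
with it `√E - 1`, is of order `t^5`. -/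
theorem exists_forall_sqrt_mul_fairTie_sub_le : ∃ C, 0 ≤ C ∧ ∀ n : ℕ, 1 ≤ n →
    |√(Real.pi * n) * fairTie n - fairTieSeries (1 / n)| ≤ C * (1 / (n : ℝ)) ^ 5 := by
  obtain ⟨K, hK0, hK⟩ := exists_forall_fairTieSeries_ratio_le
  let E : ℕ → ℝ := fun n => Real.pi * n * fairTie n ^ 2 / fairTieSeries (1 / n) ^ 2
  have hinv : ∀ n : ℕ, 1 ≤ n → 0 < 1 / (n : ℝ) ∧ 1 / (n : ℝ) ≤ 1 := fun n hn => by
    have : (1 : ℝ) ≤ n := by exact_mod_cast hn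
    exact ⟨by positivity, by rw [div_le_one (by positivity)]; exact this⟩
  have hE : Tendsto E atTop (𝓝 1) := by
    have h1 := (continuous_fairTieSeries.tendsto 0).comp
      (tendsto_one_div_atTop_nhds_zero_nat (𝕜 := ℝ))
    have h2 := tendsto_pi_mul_fairTie_sq.div (h1.pow 2) (by simp [fairTieSeries])
    have hone : (1 : ℝ) / fairTieSeries 0 ^ 2 = 1 := by norm_num [fairTieSeries]
    rw [hone] at h2
    exact h2
  obtain ⟨M, hM⟩ := hE.bddAbove_range
  have hEM : ∀ n, E n ≤ M := fun n => hM ⟨n, rfl⟩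
  have hE0 : ∀ n, 0 ≤ E n := fun n => by
    simp only [E]
    positivity
  have hM0 : 0 ≤ M := (hE0 0).trans (hEM 0)
  -- The factor `32 / 5` inverts the `5 / 32` of `hpow` below.
  have hB : Tendsto (fun n : ℕ => 32 / 5 * (M * K) * (1 / (n : ℝ)) ^ 5) atTop (𝓝 0) := by
    simpa using ((tendsto_one_div_atTop_nhds_zero_nat (𝕜 := ℝ)).pow 5).const_mul
      (32 / 5 * (M * K))
  have hstep : ∀ n : ℕ, 1 ≤ n → |(E n - 1) - (E (n + 1) - 1)| ≤
      32 / 5 * (M * K) * (1 / (n : ℝ)) ^ 5 - 32 / 5 * (M * K) * (1 / ((n + 1 : ℕ) : ℝ)) ^ 5 := by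
    intro n hn
    obtain ⟨h0, h1⟩ := hinv n hn
    have hn0 : (0 : ℝ) < n := by exact_mod_cast hn
    have hW := half_le_fairTieSeries h0.le h1
    have hratio : E (n + 1) = E n * ((2 + 1 / (n : ℝ)) ^ 2 * fairTieSeries (1 / n) ^ 2 /
        (4 * (1 + 1 / (n : ℝ)) * fairTieSeries (1 / n / (1 + 1 / n)) ^ 2)) := by
      simp only [E]
      rw [fairTie_succ_of_inv hn, one_div_natCast_succ hn]
      generalize fairTieSeries (1 / (n : ℝ) / (1 + 1 / n)) = V
      rw [show ((n + 1 : ℕ) : ℝ) = n * (1 + 1 / n) by push_cast; field_simp]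
      generalize fairTieSeries (1 / (n : ℝ)) = U at hW ⊢
      have hU : U ≠ 0 := by linarith
      generalize 1 / (n : ℝ) = t at h0
      -- For `V = 0` both sides are 0, as divisions by zero.
      rcases eq_or_ne V 0 with rfl | hV
      · simp
      field_simp
      norm_num
    rw [one_div_natCast_succ hn, hratio]
    have hKn := hK _ h0.le h1
    set r := (2 + 1 / (n : ℝ)) ^ 2 * fairTieSeries (1 / n) ^ 2 /
        (4 * (1 + 1 / (n : ℝ)) * fairTieSeries (1 / n / (1 + 1 / n)) ^ 2)
    generalize 1 / (n : ℝ) = t at h0 h1 hKn ⊢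
    have hpow : 5 / 32 * t ^ 6 ≤ t ^ 5 - (t / (1 + t)) ^ 5 := by
      have heq : t ^ 5 - (t / (1 + t)) ^ 5 = t ^ 5 * (((1 + t) ^ 5 - 1) / (1 + t) ^ 5) := by
        field_simp
      rw [heq, show 5 / 32 * t ^ 6 = t ^ 5 * (5 * t / 32) by ring]
      have h32 : (1 + t) ^ 5 ≤ 32 := by
        calc (1 + t) ^ 5 ≤ 2 ^ 5 := by gcongr; linarith
          _ = 32 := by norm_num
      have h5 : 5 * t ≤ (1 + t) ^ 5 - 1 := by
        have : 0 ≤ 10 * t ^ 2 + 10 * t ^ 3 + 5 * t ^ 4 + t ^ 5 := by positivity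
        nlinarith
      gcongr
      linarith
    calc |E n - 1 - (E n * r - 1)| = E n * |1 - r| := by
          rw [← abs_of_nonneg (hE0 n), ← abs_mul, abs_of_nonneg (hE0 n)]
          congr 1
          ring
      _ ≤ M * (K * t ^ 6) := by gcongr; exact hEM n
      _ = 32 / 5 * (M * K) * (5 / 32 * t ^ 6) := by ring
      _ ≤ 32 / 5 * (M * K) * (t ^ 5 - (t / (1 + t)) ^ 5) := by gcongr
      _ = _ := by ring
  obtain ⟨C, hC0, hC⟩ := exists_forall_Icc_abs_le continuous_fairTieSeries
  refine ⟨C * (32 / 5 * (M * K)), by positivity, fun n hn => ?_⟩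
  obtain ⟨h0, h1⟩ := hinv n hn
  have hmain := abs_le_of_abs_sub_succ_le hstep (by simpa using hE.sub_const 1) hB hn
  have hW := half_le_fairTieSeries h0.le h1
  have hW0 : 0 < fairTieSeries (1 / n) := by linarith
  have hsqrt : √(Real.pi * n) * fairTie n = fairTieSeries (1 / n) * √(E n) := by
    simp only [E]
    rw [Real.sqrt_div (by positivity), Real.sqrt_sq hW0.le,
      Real.sqrt_mul (x := Real.pi * n) (by positivity) (fairTie n ^ 2), Real.sqrt_sq (fairTie_pos n).le]
    field_simp
  -- `E - 1 = (√E - 1)(√E + 1)` and the last factor is at least 1.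
  have hroot : |√(E n) - 1| ≤ |E n - 1| := by
    have hfac : E n - 1 = (√(E n) - 1) * (√(E n) + 1) := by
      have := Real.sq_sqrt (hE0 n)
      linear_combination -this
    rw [hfac, abs_mul]
    refine le_mul_of_one_le_right (abs_nonneg _) ?_
    have := Real.sqrt_nonneg (E n)
    rw [abs_of_pos (by linarith)]
    linarith
  calc |√(Real.pi * n) * fairTie n - fairTieSeries (1 / n)|
      = |fairTieSeries (1 / n)| * |√(E n) - 1| := by
        rw [hsqrt, ← abs_mul]
        congr 1
        ring
    _ ≤ C * (32 / 5 * (M * K) * (1 / (n : ℝ)) ^ 5) :=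
        mul_le_mul (hC _ h0.le h1) (hroot.trans hmain) (abs_nonneg _) hC0
    _ = _ := by ring

/-! ### Asymptotic expansion of the winning probability -/

/-- The expansion in powers of `t = 1 / n` of the solution `s` of
`s n - (1 - y) * fairTie (n + 1) / fairTie n * s (n + 1) = 1`. -/
noncomputable def tailSeries (y t : ℝ) : ℝ :=
  1 / y + (y - 1) / (2 * y ^ 2) * t + (y ^ 2 - 4 * y + 3) / (4 * y ^ 3) * t ^ 2 +
    (y ^ 3 - 13 * y ^ 2 + 27 * y - 15) / (8 * y ^ 4) * t ^ 3 +
    (y ^ 4 - 40 * y ^ 3 + 174 * y ^ 2 - 240 * y + 105) / (16 * y ^ 5) * t ^ 4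

/-- The product of `fairTieSeries` and `tailSeries y`, truncated after the fourth power. -/
noncomputable def winSeries (y t : ℝ) : ℝ :=
  1 / y + (3 * y - 4) / (8 * y ^ 2) * t + (25 * y ^ 2 - 120 * y + 96) / (128 * y ^ 3) * t ^ 2 +
    (105 * y ^ 3 - 1540 * y ^ 2 + 3360 * y - 1920) / (1024 * y ^ 4) * t ^ 3 +
    (1659 * y ^ 4 - 75600 * y ^ 3 + 342720 * y ^ 2 - 483840 * y + 215040) / (32768 * y ^ 5) *
      t ^ 4

theorem continuous_tailSeries (y : ℝ) : Continuous (tailSeries y) := by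
  unfold tailSeries
  fun_prop

/-- The left side of the recurrence has `t^k`-coefficient `y * s_k` plus terms in earlier
coefficients, so the `s_k` are found one by one, dividing by `y` each time. Stopping at `s_4` leaves
a defect of order `t^5`, with cofactor `G`. -/
theorem exists_forall_tailSeries_recurrence_le {y : ℝ} (hy : 0 < y) : ∃ C, 0 ≤ C ∧
    ∀ t, 0 ≤ t → t ≤ 1 → |tailSeries y t -
      (1 - y) * ((2 + t) / (2 + 2 * t)) * tailSeries y (t / (1 + t)) - 1| ≤ C * t ^ 5 := by
  let G : ℝ → ℝ := fun t =>
    945 - 2625 * y + 2550 * y ^ 2 - 990 * y ^ 3 + 121 * y ^ 4 - y ^ 5 + 2100 * t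
    - 5400 * t * y + 4680 * t * y ^ 2 - 1496 * t * y ^ 3 + 116 * t * y ^ 4 + 2100 * t ^ 2
    - 5100 * t ^ 2 * y + 4044 * t ^ 2 * y ^ 2 - 1092 * t ^ 2 * y ^ 3 + 48 * t ^ 2 * y ^ 4
    + 1050 * t ^ 3 - 2460 * t ^ 3 * y + 1848 * t ^ 3 * y ^ 2 - 452 * t ^ 3 * y ^ 3
    + 14 * t ^ 3 * y ^ 4 + 210 * t ^ 4 - 480 * t ^ 4 * y + 348 * t ^ 4 * y ^ 2
    - 80 * t ^ 4 * y ^ 3 + 2 * t ^ 4 * y ^ 4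
  obtain ⟨C, hC0, hC⟩ := exists_forall_Icc_abs_le (f := G) (by fun_prop)
  refine ⟨C / (32 * y ^ 5), by positivity, fun t h0 h1 => ?_⟩
  have hid : tailSeries y t - (1 - y) * ((2 + t) / (2 + 2 * t)) * tailSeries y (t / (1 + t)) - 1 =
      t ^ 5 * G t / (32 * y ^ 5 * (1 + t) ^ 5) := by
    simp only [tailSeries, G]
    rw [show 2 + 2 * t = 2 * (1 + t) by ring]
    field_simp
    ring
  have hd : 0 < 32 * y ^ 5 * (1 + t) ^ 5 := by positivity
  rw [hid, abs_div, abs_mul, abs_of_nonneg (pow_nonneg h0 5), abs_of_pos hd]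
  calc t ^ 5 * |G t| / (32 * y ^ 5 * (1 + t) ^ 5) ≤ t ^ 5 * C / (32 * y ^ 5) := by
        refine div_le_div₀ (by positivity) ?_ (by positivity)
          (le_mul_of_one_le_right (by positivity) (one_le_pow₀ (by linarith)))
        gcongr
        exact hC t h0 h1
    _ = _ := by ring

/-- Only the orders `t^5` to `t^8` of the product of two quartics are dropped. -/
theorem exists_forall_fairTieSeries_mul_tailSeries_sub_le {y : ℝ} (hy : 0 < y) : ∃ C, 0 ≤ C ∧
    ∀ t, 0 ≤ t → t ≤ 1 → |fairTieSeries t * tailSeries y t - winSeries y t| ≤ C * t ^ 5 := by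
  let K : ℝ → ℝ := fun t =>
    -430080 + 975360 * y - 696960 * y ^ 2 + 154792 * y ^ 3 - 3112 * y ^ 4 + 26880 * t
    - 66240 * t * y + 52932 * t * y ^ 2 - 14064 * t * y ^ 3 + 492 * t * y ^ 4
    + 16800 * t ^ 2 - 37770 * t ^ 2 * y + 26706 * t ^ 2 * y ^ 2 - 5854 * t ^ 2 * y ^ 3
    + 118 * t ^ 2 * y ^ 4 - 2205 * t ^ 3 + 5040 * t ^ 3 * y - 3654 * t ^ 3 * y ^ 2
    + 840 * t ^ 3 * y ^ 3 - 21 * t ^ 3 * y ^ 4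
  obtain ⟨C, hC0, hC⟩ := exists_forall_Icc_abs_le (f := K) (by fun_prop)
  refine ⟨C / (524288 * y ^ 5), by positivity, fun t h0 h1 => ?_⟩
  have hid : fairTieSeries t * tailSeries y t - winSeries y t =
      t ^ 5 * K t / (524288 * y ^ 5) := by
    simp only [fairTieSeries, tailSeries, winSeries, K]
    field_simp
    ring
  have hd : 0 < 524288 * y ^ 5 := by positivity
  rw [hid, abs_div, abs_mul, abs_of_nonneg (pow_nonneg h0 5), abs_of_pos hd]
  calc t ^ 5 * |K t| / (524288 * y ^ 5) ≤ t ^ 5 * C / (524288 * y ^ 5) := by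
        gcongr
        exact hC t h0 h1
    _ = _ := by ring

theorem winSeries_one_sub_two_mul_sq {q t : ℝ} (hq : 1 - 2 * q ≠ 0) :
    winSeries ((1 - 2 * q) ^ 2) t = 1 / (1 - 2 * q) ^ 2 *
          (1 + (12 * q ^ 2 - 12 * q - 1) / (8 * (2 * q - 1) ^ 2) * t
            + 1 / 128 * ((400 * q ^ 4 - 800 * q ^ 3 + 120 * q ^ 2 + 280 * q + 1)
                / (2 * q - 1) ^ 4) * (t ^ 2)
            + 5 / 1024 * ((1344 * q ^ 6 - 4032 * q ^ 5 + 112 * q ^ 4 + 6496 * q ^ 3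
                - 3444 * q ^ 2 - 476 * q + 1) / (2 * q - 1) ^ 6) * (t ^ 3)
            + 21 / 32768 * ((20224 * q ^ 8 - 80896 * q ^ 7 - 88832 * q ^ 6 + 549632 * q ^ 5
                - 514400 * q ^ 4 + 18368 * q ^ 3 + 92368 * q ^ 2 + 3536 * q - 1)
                / (2 * q - 1) ^ 8) * (t ^ 4)) := by
  -- In terms of `d = 1 - 2q` every denominator is a power of `d` up to a numerical factor.
  obtain ⟨d, rfl⟩ : ∃ d, q = (1 - d) / 2 := ⟨1 - 2 * q, by ring⟩
  have h1 : 1 - 2 * ((1 - d) / 2) = d := by ring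
  have h2 : 2 * ((1 - d) / 2) - 1 = -d := by ring
  rw [h1] at hq
  rw [winSeries, h1, h2]
  field_simp
  ring

/-- A null sequence `R` with `R n - R (n + 1) = a * (1 - y) ^ n * fairTie n` has an expansion in
powers of `1 / n` relative to `(1 - y) ^ n / √n`. -/
theorem exists_forall_sub_winSeries_le {R : ℕ → ℝ} {a y : ℝ} (hy0 : 0 < y) (hy1 : y < 1)
    (hR : ∀ n, R n - R (n + 1) = a * (1 - y) ^ n * fairTie n) (hlim : Tendsto R atTop (𝓝 0)) :
    ∃ C, ∀ n : ℕ, 1 ≤ n →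
      |R n - a * (1 - y) ^ n / √(Real.pi * n) * winSeries y (1 / n)| ≤
        C * ((1 - y) ^ n * ((1 / (n : ℝ)) ^ 5 / √n)) := by
  obtain ⟨K₁, hK₁, hrec⟩ := exists_forall_tailSeries_recurrence_le hy0
  obtain ⟨K₂, hK₂, hprod⟩ := exists_forall_fairTieSeries_mul_tailSeries_sub_le hy0
  obtain ⟨K₃, hK₃, hfair⟩ := exists_forall_sqrt_mul_fairTie_sub_le
  obtain ⟨Q, hQ, htail⟩ := exists_forall_Icc_abs_le (continuous_tailSeries y)
  obtain ⟨S, hS, hseries⟩ := exists_forall_Icc_abs_le continuous_fairTieSeries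
  have hx0 : 0 < 1 - y := by linarith
  have hinv : ∀ n : ℕ, 1 ≤ n → 0 < 1 / (n : ℝ) ∧ 1 / (n : ℝ) ≤ 1 := fun n hn => by
    have : (1 : ℝ) ≤ n := by exact_mod_cast hn
    exact ⟨by positivity, by rw [div_le_one (by positivity)]; exact this⟩
  have hpow : Tendsto (fun n : ℕ => (1 - y) ^ n) atTop (𝓝 0) :=
    tendsto_pow_atTop_nhds_zero_of_lt_one hx0.le (by linarith)
  let D : ℕ → ℝ := fun n => R n - a * (1 - y) ^ n * fairTie n * tailSeries y (1 / n)
  -- `B` shrinks at least by the factor `1 - y` per step, so its decrement is at least `y * B n`;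
  -- the division by `y` makes this cover the defect. Thus no power of `n` is lost here.
  let B : ℕ → ℝ := fun n => |a| * K₁ / y * ((1 - y) ^ n * fairTie n * (1 / (n : ℝ)) ^ 5)
  have hD : Tendsto D atTop (𝓝 0) := by
    have h1 : Tendsto (fun n : ℕ => a * (1 - y) ^ n * fairTie n * tailSeries y (1 / n)) atTop
        (𝓝 0) := by
      refine squeeze_zero_norm' (a := fun n : ℕ => |a| * Q * (1 - y) ^ n) ?_
        (by simpa using hpow.const_mul (|a| * Q))
      filter_upwards [eventually_ge_atTop 1] with n hn
      obtain ⟨h0, h1⟩ := hinv n hn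
      rw [Real.norm_eq_abs, abs_mul, abs_mul, abs_mul, abs_of_pos (pow_pos hx0 n),
        abs_of_pos (fairTie_pos n)]
      calc |a| * (1 - y) ^ n * fairTie n * |tailSeries y (1 / n)|
          ≤ |a| * (1 - y) ^ n * 1 * Q := by
            gcongr
            · exact fairTie_le_one n
            · exact htail _ h0.le h1
        _ = _ := by ring
    rw [← sub_zero (0 : ℝ)]
    exact hlim.sub h1
  have hB : Tendsto B atTop (𝓝 0) := by
    refine squeeze_zero_norm' (a := fun n : ℕ => |a| * K₁ / y * (1 - y) ^ n) ?_
      (by simpa using hpow.const_mul (|a| * K₁ / y))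
    filter_upwards [eventually_ge_atTop 1] with n hn
    obtain ⟨h0, h1⟩ := hinv n hn
    have hf := fairTie_pos n
    rw [Real.norm_eq_abs, abs_of_nonneg (by positivity)]
    calc |a| * K₁ / y * ((1 - y) ^ n * fairTie n * (1 / (n : ℝ)) ^ 5)
        ≤ |a| * K₁ / y * ((1 - y) ^ n * 1 * 1) := by
          gcongr
          · exact fairTie_le_one n
          · exact pow_le_one₀ h0.le h1
      _ = _ := by ring
  have hstep : ∀ n : ℕ, 1 ≤ n → |D n - D (n + 1)| ≤ B n - B (n + 1) := by
    intro n hn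
    obtain ⟨h0, h1⟩ := hinv n hn
    have hf := fairTie_pos n
    have hDn : D n - D (n + 1) = -(a * (1 - y) ^ n * fairTie n * (tailSeries y (1 / n) -
        (1 - y) * ((2 + 1 / (n : ℝ)) / (2 + 2 * (1 / n))) *
          tailSeries y (1 / n / (1 + 1 / n)) - 1)) := by
      simp only [D]
      rw [one_div_natCast_succ hn, fairTie_succ_of_inv hn, pow_succ]
      linear_combination hR n
    have hBsucc : B (n + 1) ≤ (1 - y) * B n := by
      simp only [B]
      have hle : fairTie (n + 1) ≤ fairTie n := by
        rw [fairTie_succ]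
        refine mul_le_of_le_one_right hf.le ?_
        rw [div_le_one (by positivity)]
        linarith
      have hn0 : (0 : ℝ) < n := by exact_mod_cast hn
      calc |a| * K₁ / y * ((1 - y) ^ (n + 1) * fairTie (n + 1) * (1 / ((n + 1 : ℕ) : ℝ)) ^ 5)
          ≤ |a| * K₁ / y * ((1 - y) ^ (n + 1) * fairTie n * (1 / (n : ℝ)) ^ 5) := by
            gcongr
            exact Nat.le_succ n
        _ = _ := by ring
    rw [hDn, abs_neg, abs_mul, abs_mul, abs_mul, abs_of_pos (pow_pos hx0 n), abs_of_pos hf]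
    calc _ ≤ |a| * (1 - y) ^ n * fairTie n * (K₁ * (1 / (n : ℝ)) ^ 5) := by
          gcongr
          exact hrec _ h0.le h1
      _ = y * B n := by
          simp only [B]
          field_simp
      _ ≤ B n - B (n + 1) := by linarith
  have hsqrtpi : 1 ≤ √Real.pi := Real.one_le_sqrt.2 (by linarith [Real.pi_gt_three])
  -- Supplies the factor `1 / √n` that `B` needs for the final error.
  have hweak : ∀ n : ℕ, 1 ≤ n → fairTie n ≤ (S + K₃) / √n := by
    intro n hn
    obtain ⟨h0, h1⟩ := hinv n hn
    have hn0 : (0 : ℝ) < n := by exact_mod_cast hn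
    have hf := fairTie_pos n
    rw [le_div_iff₀ (by positivity)]
    have h2 := (abs_le.1 (hfair n hn)).2
    have h3 := (abs_le.1 (hseries _ h0.le h1)).2
    have h4 : K₃ * (1 / (n : ℝ)) ^ 5 ≤ K₃ := mul_le_of_le_one_right hK₃ (pow_le_one₀ h0.le h1)
    rw [Real.sqrt_mul Real.pi_pos.le] at h2
    have h5 : fairTie n * √n ≤ √Real.pi * √n * fairTie n := by
      calc fairTie n * √n ≤ √Real.pi * (fairTie n * √n) :=
            le_mul_of_one_le_left (by positivity) hsqrtpi
        _ = _ := by ring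
    linarith
  refine ⟨|a| * K₁ / y * (S + K₃) + |a| * (K₃ * Q + K₂), fun n hn => ?_⟩
  obtain ⟨h0, h1⟩ := hinv n hn
  have hn0 : (0 : ℝ) < n := by exact_mod_cast hn
  have hDB := abs_le_of_abs_sub_succ_le hstep hD hB hn
  -- Three errors: the tail recurrence, the expansion of `fairTie`, and the truncation of the
  -- product.
  have hsplit : R n - a * (1 - y) ^ n / √(Real.pi * n) * winSeries y (1 / n) =
      D n + a * (1 - y) ^ n * (((√(Real.pi * n) * fairTie n - fairTieSeries (1 / n)) *
        tailSeries y (1 / n) + (fairTieSeries (1 / n) * tailSeries y (1 / n) -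
          winSeries y (1 / n))) / √(Real.pi * n)) := by
    have hs : √(Real.pi * n) ≠ 0 := by positivity
    simp only [D]
    field_simp
    ring
  have hBn : B n ≤ |a| * K₁ / y * (S + K₃) * ((1 - y) ^ n * ((1 / (n : ℝ)) ^ 5 / √n)) := by
    calc B n ≤ |a| * K₁ / y * ((1 - y) ^ n * ((S + K₃) / √n) * (1 / (n : ℝ)) ^ 5) := by
          simp only [B]
          gcongr
          exact hweak n hn
      _ = _ := by ring
  have hsqrt : √(n : ℝ) ≤ √(Real.pi * n) := by
    rw [Real.sqrt_mul Real.pi_pos.le]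
    exact le_mul_of_one_le_left (Real.sqrt_nonneg _) hsqrtpi
  have hrest : |a * (1 - y) ^ n * (((√(Real.pi * n) * fairTie n - fairTieSeries (1 / n)) *
        tailSeries y (1 / n) + (fairTieSeries (1 / n) * tailSeries y (1 / n) -
          winSeries y (1 / n))) / √(Real.pi * n))| ≤
      |a| * (K₃ * Q + K₂) * ((1 - y) ^ n * ((1 / (n : ℝ)) ^ 5 / √n)) := by
    rw [abs_mul, abs_mul, abs_div, abs_of_pos (pow_pos hx0 n), abs_of_nonneg (Real.sqrt_nonneg _)]
    have hnum := (abs_add_le ((√(Real.pi * n) * fairTie n - fairTieSeries (1 / n)) *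
        tailSeries y (1 / n)) (fairTieSeries (1 / n) * tailSeries y (1 / n) -
          winSeries y (1 / n))).trans (add_le_add ((abs_mul _ _).trans_le
            (mul_le_mul (hfair n hn) (htail _ h0.le h1) (abs_nonneg _) (by positivity)))
            (hprod _ h0.le h1))
    calc _ ≤ |a| * (1 - y) ^ n * ((K₃ * (1 / (n : ℝ)) ^ 5 * Q + K₂ * (1 / (n : ℝ)) ^ 5) / √n) := by
          gcongr
      _ = _ := by ring
  rw [hsplit, add_mul]
  exact (abs_add_le _ _).trans (add_le_add (hDB.trans hBn) hrest)

theorem theorem2 {Ω : Type*} [MeasurableSpace Ω] (μ : MeasureTheory.Measure Ω)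
    [MeasureTheory.IsProbabilityMeasure μ] (q : ℝ) (hq0 : 0 < q) (hq : q < 1 / 2)
    (X : ℕ → Ω → Bool) (hmeas : ∀ k, Measurable (X k))
    (hindep : ProbabilityTheory.iIndepFun X μ)
    (hlaw : ∀ k, μ.real {ω | X k ω = true} = q) :
    (fun n : ℕ => rosenfeld μ X n -
        (4 * q * (1 - q)) ^ n / (Real.sqrt Real.pi * (1 - 2 * q)) * (1 / Real.sqrt n) *
          (1 + (12 * q ^ 2 - 12 * q - 1) / (8 * (2 * q - 1) ^ 2) * (1 / (n : ℝ))
            + 1 / 128 * ((400 * q ^ 4 - 800 * q ^ 3 + 120 * q ^ 2 + 280 * q + 1)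
                / (2 * q - 1) ^ 4) * (1 / (n : ℝ) ^ 2)
            + 5 / 1024 * ((1344 * q ^ 6 - 4032 * q ^ 5 + 112 * q ^ 4 + 6496 * q ^ 3
                - 3444 * q ^ 2 - 476 * q + 1) / (2 * q - 1) ^ 6) * (1 / (n : ℝ) ^ 3)
            + 21 / 32768 * ((20224 * q ^ 8 - 80896 * q ^ 7 - 88832 * q ^ 6 + 549632 * q ^ 5
                - 514400 * q ^ 4 + 18368 * q ^ 3 + 92368 * q ^ 2 + 3536 * q - 1)
                / (2 * q - 1) ^ 8) * (1 / (n : ℝ) ^ 4)))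
      =O[Filter.atTop] (fun n : ℕ => (4 * q * (1 - q)) ^ n * (n : ℝ) ^ (-(11 / 2) : ℝ)) := by
  have hproc : IsGoalProcess μ q X := ⟨hmeas, hindep, hlaw⟩
  have hd : 0 < 1 - 2 * q := by linarith
  have hy1 : (1 - 2 * q) ^ 2 < 1 := by nlinarith
  have hxy : 4 * q * (1 - q) = 1 - (1 - 2 * q) ^ 2 := by ring
  obtain ⟨C, hC⟩ := exists_forall_sub_winSeries_le (R := rosenfeld μ X) (a := 1 - 2 * q)
    (pow_pos hd 2) hy1 (fun n => by
      rw [hproc.rosenfeld_sub_succ hq0 hq, hxy, fairTie]) (hproc.tendsto_rosenfeld hq)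
  refine Asymptotics.IsBigO.of_bound C ?_
  filter_upwards [Filter.eventually_ge_atTop 1] with n hn
  have hn0 : (0 : ℝ) < n := by exact_mod_cast hn
  have hpow : (1 / (n : ℝ)) ^ 5 / √n = (n : ℝ) ^ (-(11 / 2) : ℝ) := by
    rw [Real.rpow_neg hn0.le, show (11 / 2 : ℝ) = (5 : ℕ) + 1 / 2 by norm_num,
      Real.rpow_add hn0, Real.rpow_natCast, ← Real.sqrt_eq_rpow]
    field_simp
  have hx : 0 < 4 * q * (1 - q) := by
    have : 0 < 1 - q := by linarith
    positivity
  rw [← hpow, Real.norm_eq_abs, Real.norm_eq_abs, abs_of_nonneg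
    (a := (4 * q * (1 - q)) ^ n * ((1 / (n : ℝ)) ^ 5 / √n)) (by positivity)]
  refine le_of_eq_of_le (congrArg abs (congrArg _ ?_)) (hxy ▸ hC n hn)
  rw [winSeries_one_sub_two_mul_sq hd.ne', Real.sqrt_mul Real.pi_pos.le]
  simp only [one_div_pow]
  have hs : √(n : ℝ) ≠ 0 := by positivity
  have hp : √Real.pi ≠ 0 := by positivity
  -- The prefactor `1 - 2q` meets the `1 / (1 - 2q)^2` from `winSeries`, which leaves `1 / (1 -
  -- 2q)`.
  rw [show (1 - 2 * q) * (4 * q * (1 - q)) ^ n / (√Real.pi * √n) =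
    (4 * q * (1 - q)) ^ n / (√Real.pi * (1 - 2 * q)) * (1 / √n) * (1 - 2 * q) ^ 2 by
      field_simp]
  rw [mul_assoc _ ((1 - 2 * q) ^ 2), ← mul_assoc ((1 - 2 * q) ^ 2),
    mul_one_div_cancel (pow_ne_zero 2 hd.ne'), one_mul]
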